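/- Let $n\ge 2$, let $X=(X_1,\dots,X_n)$ be a random vector in $\mathbb R^n$, let $Y$ be a real random variable with $P\{Y=0\}<1$ (possibly on another probability space), and let $\gamma:\mathbb R^n\to\mathbb R$ be a function such that $\gamma(a)>0$ for every $a\ne 0$ and, for every $a\in\mathbb R^n$, the random variables $\sum_{i=1}^n a_iX_i$ and $\gamma(a)Y$ are identically distributed (that is, $X$ is an $n$-dimensional version of $Y$ with standard $\gamma$). Then there exists an origin-symmetric star body $K$ in $\mathbb R^n$ such that $\gamma=\|\cdot\|_K$ and the space $(\mathbb R^n,\|\cdot\|_K)$ embeds in $L_0$. Here a closed bounded set $K\subset\mathbb R^n$ is a star body if the origin is an interior point of $K$, every straight line through the origin meets the boundary of $K$ at exactly two points, and the Minkowski functional $\|x\|_K=\min\{s\ge 0: x\in sK\}$ is a continuous function on $\mathbb R^n$; $K$ is origin-symmetric if $-K=K$. The space $(\mathbb R^n,\|\cdot\|_K)$ embeds in $L_0$ if there exist a finite Borel measure $\mu$ on the unit sphere $S^{n-1}$ and a constant $C\in\mathbb R$ such that, for every $x\in\mathbb R^n\setminus\{0\}$, the function $\xi\mapsto\ln|(x,\xi)|$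 (with $\ln 0=-\infty$) is $\mu$-integrable and $$\ln\|x\|_K=\int_{S^{n-1}}\ln|(x,\xi)|\,d\mu(\xi)+C.$$ -/

import Mathlib

open MeasureTheory ProbabilityTheory
open scoped Pointwise

/-- `γ` is the standard of the random vector `X = (X₁, …, Xₙ)`, and `X` is an `n`-dimensional
version of the random variable `Y`: `γ a > 0` for `a ≠ 0`, and for every `a` the random variables
`∑ aᵢ Xᵢ` and `γ(a) Y` are identically distributed. The vector and the variable may live on
different probability spaces. -/
structure IsVersionWithStandard {n : ℕ} {Ω Ω' : Type*} [MeasurableSpace Ω] [MeasurableSpace Ω']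
    (P : Measure Ω) (P' : Measure Ω') (X : Ω → EuclideanSpace ℝ (Fin n)) (Y : Ω' → ℝ)
    (γ : EuclideanSpace ℝ (Fin n) → ℝ) : Prop where
  aemeasurable_vector : AEMeasurable X P
  aemeasurable_variable : AEMeasurable Y P'
  pos : ∀ a, a ≠ 0 → 0 < γ a
  identDistrib : ∀ a : EuclideanSpace ℝ (Fin n),
    IdentDistrib (fun ω => ∑ i, a i * X ω i) (fun ω' => γ a * Y ω') P P'

/-- A star body in `ℝⁿ`: a closed bounded set with the origin in its interior, such that every
straight line through the origin meets the boundary in exactly two points and the Minkowski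
functional is continuous. The Minkowski functional is `gauge K`; see `IsStarBody.isLeast_gauge`. -/
structure IsStarBody {n : ℕ} (K : Set (EuclideanSpace ℝ (Fin n))) : Prop where
  isClosed : IsClosed K
  isBounded : Bornology.IsBounded K
  line_inter_frontier : ∀ u : EuclideanSpace ℝ (Fin n), u ≠ 0 →
    (frontier K ∩ Set.range (fun t : ℝ => t • u)).ncard = 2
  zero_mem_interior : (0 : EuclideanSpace ℝ (Fin n)) ∈ interior K
  continuous_gauge : Continuous (gauge K)

/-- For a star body, `gauge K x` is the minimum of the `s ≥ 0` with `x ∈ s K`. -/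
theorem IsStarBody.isLeast_gauge {n : ℕ} {K : Set (EuclideanSpace ℝ (Fin n))} (hK : IsStarBody K)
    (x : EuclideanSpace ℝ (Fin n)) : IsLeast {s : ℝ | 0 ≤ s ∧ x ∈ s • K} (gauge K x) := by
  have h0 : (0 : EuclideanSpace ℝ (Fin n)) ∈ K := interior_subset hK.zero_mem_interior
  have habs : Absorbent ℝ K := absorbent_nhds_zero (mem_interior_iff_mem_nhds.1 hK.zero_mem_interior)
  have hb : Bornology.IsVonNBounded ℝ K := NormedSpace.isVonNBounded_of_isBounded ℝ hK.isBounded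
  rcases eq_or_ne x 0 with rfl | hx
  · rw [gauge_zero]
    exact ⟨⟨le_rfl, 0, h0, by simp⟩, fun s hs => hs.1⟩
  have hpos : 0 < gauge K x := (gauge_pos habs hb).2 hx
  refine ⟨⟨hpos.le, ?_⟩, ?_⟩
  · obtain ⟨u, -, hu, hmem⟩ := exists_seq_tendsto_sInf (S := {r : ℝ | 0 < r ∧ x ∈ r • K})
      habs.gauge_set_nonempty ⟨0, fun r hr => hr.1.le⟩
    have hu' : Filter.Tendsto u Filter.atTop (nhds (gauge K x)) := hu
    have hl : Filter.Tendsto (fun k => (u k)⁻¹ • x) Filter.atTop (nhds ((gauge K x)⁻¹ • x)) :=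
      (hu'.inv₀ hpos.ne').smul_const x
    have := hK.isClosed.mem_of_tendsto hl (Filter.Eventually.of_forall fun k =>
      (Set.mem_smul_set_iff_inv_smul_mem₀ (hmem k).1.ne' K x).1 (hmem k).2)
    exact (Set.mem_smul_set_iff_inv_smul_mem₀ hpos.ne' K x).2 this
  · rintro s ⟨hs, hxs⟩
    exact gauge_le_of_mem hs hxs

/-- The space `(ℝⁿ, N)` embeds in `L₀`: there are a finite Borel measure `μ` on the unit sphere
and a real constant `C` with `ln N(x) = ∫ ln |⟨x, ξ⟩| dμ(ξ) + C`.
The logarithms are meant with `ln 0 = -∞`. For `x ≠ 0` the equation therefore says that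
`ln |⟨x, ξ⟩|` is finite for almost every `ξ`, that it is integrable, and that its integral has the
asserted value; all three are stated because `Real.log 0 = 0`. For `x = 0` both sides are `-∞`:
when `N` is homogeneous of degree one and positive off the origin (and `n ≥ 1`), comparing `x`
with `2 x` shows that `μ` has total mass one. -/
def EmbedsInLZero {n : ℕ} (N : EuclideanSpace ℝ (Fin n) → ℝ) : Prop :=
  ∃ (μ : Measure (Metric.sphere (0 : EuclideanSpace ℝ (Fin n)) 1)) (C : ℝ),
    IsFiniteMeasure μ ∧ ∀ x : EuclideanSpace ℝ (Fin n), x ≠ 0 →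
      (∀ᵐ ξ : Metric.sphere (0 : EuclideanSpace ℝ (Fin n)) 1 ∂μ, inner ℝ x ξ.1 ≠ 0) ∧
      Integrable (fun ξ : Metric.sphere (0 : EuclideanSpace ℝ (Fin n)) 1 =>
        Real.log |inner ℝ x ξ.1|) μ ∧
      Real.log (N x) =
        (∫ ξ : Metric.sphere (0 : EuclideanSpace ℝ (Fin n)) 1, Real.log |inner ℝ x ξ.1| ∂μ) + C

/-! The number `γ a` is determined by the law of `γ a * |Y|` through the strictly increasing
function `c ↦ E arctan (c |Y|)`, which needs no moments of `Y`. Hence `γ` is absolutely homogeneous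
and continuous, and `K = {γ ≤ 1}` is the star body. For the embedding, `ln |⟨a, X⟩|` and `ln γ(a) +
ln |Y|` have the same law off the event that both sides vanish. Subtracting the same identity for
`b` formally removes `ln |Y|` on one side and `ln ‖X‖` on the other, leaving a logarithmic integral
over the direction `X / ‖X‖`. The law of that direction, divided by `P(Y ≠ 0)`, is the representing
measure. Since `ln |Y|` need not be integrable, the logarithms are first clamped to `[-T, T]` and
then `T → ∞`. Gaussian averaging shows that hyperplanes are null off the origin
(`ae_inner_ne_zero_of_measure_eq`) and that the integral is finite for one direction;
`integrable_log_inner_direction` extends this to all. -/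

/-! ### Truncation and limits of differences. -/

section Clamp

/-- The number `s` clamped to `[-T, T]`. -/
noncomputable def clamp (T : ℕ) (s : ℝ) : ℝ := max (-(T : ℝ)) (min s T)

theorem abs_clamp_le (T : ℕ) (s : ℝ) : |clamp T s| ≤ T := by
  have : (0 : ℝ) ≤ T := T.cast_nonneg
  rw [abs_le]
  exact ⟨le_max_left _ _, max_le (by linarith) (min_le_right _ _)⟩

theorem abs_clamp_sub_clamp_le (T : ℕ) (s t : ℝ) : |clamp T s - clamp T t| ≤ |s - t| := by
  refine (abs_max_sub_max_le_max _ _ _ _).trans ?_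
  rw [sub_self, abs_zero, max_eq_right (abs_nonneg _)]
  refine (abs_min_sub_min_le_max _ _ _ _).trans ?_
  rw [sub_self, abs_zero, max_eq_left (abs_nonneg _)]

theorem clamp_mono (T : ℕ) : Monotone (clamp T) := fun _ _ h =>
  max_le_max le_rfl (min_le_min h le_rfl)

@[fun_prop]
theorem measurable_clamp (T : ℕ) : Measurable (clamp T) := by
  unfold clamp
  fun_prop

theorem tendsto_clamp (s : ℝ) :
    Filter.Tendsto (fun T => clamp T s) Filter.atTop (nhds s) := by
  refine tendsto_const_nhds.congr' ?_
  filter_upwards [Filter.eventually_ge_atTop ⌈|s|⌉₊] with T hT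
  have h : |s| ≤ T := Nat.ceil_le.1 hT
  rw [abs_le] at h
  rw [clamp, min_eq_left h.2, max_eq_right h.1]

variable {α : Type*} [MeasurableSpace α] {κ : Measure α} [IsFiniteMeasure κ]

theorem integrable_clamp_comp (T : ℕ) {g : α → ℝ} (hg : AEMeasurable g κ) :
    Integrable (fun x => clamp T (g x)) κ :=
  Integrable.of_bound ((measurable_clamp T).comp_aemeasurable hg).aestronglyMeasurable T
    (Filter.Eventually.of_forall fun _ => abs_clamp_le T _)

/-- Clamping is 1-Lipschitz, so `|g - h|` dominates, even when `g` and `h` are not integrable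
separately. -/
theorem tendsto_integral_clamp_sub_clamp {g h : α → ℝ} (hg : AEMeasurable g κ)
    (hh : AEMeasurable h κ) (hi : Integrable (fun x => g x - h x) κ) :
    Filter.Tendsto (fun T => ∫ x, (clamp T (g x) - clamp T (h x)) ∂κ) Filter.atTop
      (nhds (∫ x, (g x - h x) ∂κ)) := by
  refine tendsto_integral_of_dominated_convergence (fun x => |g x - h x|)
    (fun T => ((integrable_clamp_comp T hg).sub (integrable_clamp_comp T hh)).1) hi.abs
    (fun T => Filter.Eventually.of_forall fun x => abs_clamp_sub_clamp_le T _ _)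
    (Filter.Eventually.of_forall fun x => (tendsto_clamp _).sub (tendsto_clamp _))

/-- Fatou's lemma: the clamped differences are nonnegative because clamping is monotone. -/
theorem integrable_sub_of_integral_clamp_le {g h : α → ℝ} (hg : AEMeasurable g κ)
    (hh : AEMeasurable h κ) (hle : ∀ᵐ x ∂κ, h x ≤ g x) (B : ℝ)
    (hB : ∀ T : ℕ, ∫ x, (clamp T (g x) - clamp T (h x)) ∂κ ≤ B) :
    Integrable (fun x => g x - h x) κ := by
  have hm : ∀ T, Integrable (fun x => clamp T (g x) - clamp T (h x)) κ := fun T =>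
    (integrable_clamp_comp T hg).sub (integrable_clamp_comp T hh)
  refine ⟨(hg.sub hh).aestronglyMeasurable, ?_⟩
  rw [hasFiniteIntegral_iff_ofReal (hle.mono fun x hx => sub_nonneg.2 hx)]
  refine lt_of_le_of_lt ?_ (ENNReal.ofReal_lt_top (r := B))
  calc ∫⁻ x, ENNReal.ofReal (g x - h x) ∂κ
      = ∫⁻ x, Filter.liminf (fun T : ℕ => ENNReal.ofReal (clamp T (g x) - clamp T (h x)))
          Filter.atTop ∂κ := by
        refine lintegral_congr fun x => ?_
        exact ((ENNReal.continuous_ofReal.tendsto _).comp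
          ((tendsto_clamp (g x)).sub (tendsto_clamp (h x)))).liminf_eq.symm
    _ ≤ Filter.liminf (fun T : ℕ => ∫⁻ x, ENNReal.ofReal (clamp T (g x) - clamp T (h x)) ∂κ)
          Filter.atTop :=
        lintegral_liminf_le' fun T => (hm T).1.aemeasurable.ennreal_ofReal
    _ ≤ ENNReal.ofReal B := by
        refine Filter.liminf_le_of_le (by isBoundedDefault) fun b hb => ?_
        obtain ⟨T, hT⟩ := hb.exists
        refine hT.trans ?_
        rw [← ofReal_integral_eq_lintegral_ofReal (hm T)
          (hle.mono fun x hx => sub_nonneg.2 (clamp_mono T hx))]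
        exact ENNReal.ofReal_le_ofReal (hB T)

end Clamp

/-! ### Averaging over a Gaussian direction. -/

section Gaussian

/-- Near the origin the density is bounded and `log` is Lebesgue integrable; elsewhere `|log x| ≤
|x|`. -/
theorem integrable_log_gaussianReal : Integrable Real.log (gaussianReal 0 1) := by
  have hle : gaussianReal 0 1 ≤ ENNReal.ofReal (√(2 * Real.pi))⁻¹ • (volume : Measure ℝ) := by
    rw [gaussianReal_of_var_ne_zero 0 one_ne_zero, ← withDensity_const]
    refine withDensity_mono (Filter.Eventually.of_forall fun x => ?_)
    refine ENNReal.ofReal_le_ofReal ?_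
    rw [gaussianPDFReal]
    simp only [NNReal.coe_one, mul_one, sub_zero]
    refine mul_le_of_le_one_right (by positivity) (Real.exp_le_one_iff.2 ?_)
    have := sq_nonneg x
    linarith
  have h1 : IntegrableOn Real.log (Set.uIoc (-1) 1) (gaussianReal 0 1) := by
    have h := intervalIntegrable_iff.1
      (intervalIntegral.intervalIntegrable_log' (a := -1) (b := 1))
    exact ((Integrable.smul_measure (c := ENNReal.ofReal (√(2 * Real.pi))⁻¹) h
      ENNReal.ofReal_ne_top).mono_measure (by
        rw [← Measure.restrict_smul]; exact Measure.restrict_mono le_rfl hle))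
  have h2 : Integrable (fun x : ℝ => x) (gaussianReal 0 1) :=
    memLp_one_iff_integrable.1 (memLp_id_gaussianReal 1)
  have h3 := ((integrable_indicator_iff measurableSet_uIoc).2 h1).abs.add h2.abs
  refine h3.mono' Real.measurable_log.aestronglyMeasurable
    (Filter.Eventually.of_forall fun x => ?_)
  by_cases hx : x ∈ Set.uIoc (-1 : ℝ) 1
  · simp only [Pi.add_apply, Set.indicator_of_mem hx, Real.norm_eq_abs]
    linarith [abs_nonneg x]
  · simp only [Pi.add_apply, hx, not_false_eq_true, Set.indicator_of_notMem, abs_zero, zero_add,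
      Real.norm_eq_abs]
    rw [Set.uIoc_of_le (by norm_num)] at hx
    have hx1 : 1 ≤ |x| := by
      by_contra! h
      rw [abs_lt] at h
      exact hx ⟨h.1, h.2.le⟩
    rw [← Real.log_abs, abs_of_nonneg (Real.log_nonneg hx1)]
    exact (Real.log_le_sub_one_of_pos (by linarith)).trans (by linarith)

variable {E : Type*} [NormedAddCommGroup E] [InnerProductSpace ℝ E] [FiniteDimensional ℝ E]
  [MeasurableSpace E] [BorelSpace E]

theorem map_inner_stdGaussian (x : E) (hx : ‖x‖ = 1) :
    (stdGaussian E).map (fun a => inner ℝ a x) = gaussianReal 0 1 := by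
  have h := IsGaussian.map_eq_gaussianReal (μ := stdGaussian E) (innerSL ℝ x)
  rw [integral_strongDual_stdGaussian, variance_dual_stdGaussian, innerSL_apply_norm, hx] at h
  simpa [real_inner_comm] using h

theorem stdGaussian_inner_eq_zero (x : E) (hx : x ≠ 0) :
    stdGaussian E {a | inner ℝ a x = 0} = 0 := by
  have h1 : ‖‖x‖⁻¹ • x‖ = 1 := norm_smul_inv_norm (𝕜 := ℝ) hx
  have h := map_inner_stdGaussian _ h1
  have h2 : gaussianReal 0 1 {0} = 0 := by
    have := nullSingletonClass_gaussianReal (μ := 0) (v := 1) one_ne_zero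
    exact measure_singleton 0
  rw [← h, Measure.map_apply (by fun_prop) (measurableSet_singleton 0)] at h2
  convert h2 using 2
  ext a
  simp [inner_smul_right, hx]

/-- If hyperplanes through the origin all have the same measure, they are null off the origin. -/
theorem ae_inner_ne_zero_of_measure_eq [Nontrivial E] {ν : Measure E} [IsFiniteMeasure ν]
    (p : ENNReal) (hp : ∀ a : E, a ≠ 0 → ν {x | inner ℝ a x = 0} = p) (a : E) (ha : a ≠ 0) :
    ∀ᵐ x ∂ν, x ≠ 0 → inner ℝ a x ≠ 0 := by
  -- By Fubini almost every Gaussian `b` works. For such a `b` the common value `p` equals `ν {0}`,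
  -- which then settles every other hyperplane.
  have key : ∃ b : E, b ≠ 0 ∧ ∀ᵐ x ∂ν, x ≠ 0 → inner ℝ b x ≠ 0 := by
    have hms : MeasurableSet {z : E × E | z.2 ≠ 0 → inner ℝ z.1 z.2 ≠ 0} := by
      have h1 : MeasurableSet {z : E × E | z.2 = 0} :=
        measurable_snd (measurableSet_singleton 0)
      have h2 : MeasurableSet {z : E × E | inner ℝ z.1 z.2 = 0} :=
        (measurable_fst.inner measurable_snd) (measurableSet_singleton (0 : ℝ))
      convert h1.union h2.compl using 1
      ext z
      simp only [Set.mem_ofPred_eq, Set.mem_union, Set.mem_compl_iff]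
      tauto
    have h1 : ∀ᵐ x ∂ν, ∀ᵐ b ∂(stdGaussian E), x ≠ 0 → inner ℝ b x ≠ 0 := by
      refine Filter.Eventually.of_forall fun x => ?_
      by_cases hx : x = 0
      · simp [hx]
      · filter_upwards [measure_eq_zero_iff_ae_notMem.1 (stdGaussian_inner_eq_zero x hx)] with b hb _
        exact hb
    have h2 : ∀ᵐ b ∂(stdGaussian E), ∀ᵐ x ∂ν, x ≠ 0 → inner ℝ b x ≠ 0 := by
      have := (Measure.ae_ae_comm (μ := ν) (ν := stdGaussian E)
        (p := fun x b => x ≠ 0 → inner ℝ b x ≠ 0)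
        (hms.preimage measurable_swap)).1 h1
      exact this
    have h3 : ∀ᵐ b ∂(stdGaussian E), b ≠ 0 := by
      obtain ⟨e, he⟩ := exists_ne (0 : E)
      filter_upwards [measure_eq_zero_iff_ae_notMem.1 (stdGaussian_inner_eq_zero e he)] with b hb h
      exact hb (by simp [h])
    exact (h3.and h2).exists
  obtain ⟨b, hb, hbx⟩ := key
  have hb0 : ν {x | inner ℝ b x = 0} = ν {0} := by
    refine measure_congr ?_
    filter_upwards [hbx] with x hx
    refine propext ⟨fun h => ?_, fun h => ?_⟩
    · by_contra h0
      exact hx h0 h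
    · have h' : x = 0 := h
      change inner ℝ b x = 0
      simp [h']
  have hsub : ({0} : Set E) ⊆ {x | inner ℝ a x = 0} := by simp
  have hd : ν ({x | inner ℝ a x = 0} \ {0}) = 0 := by
    rw [measure_sdiff hsub (measurableSet_singleton 0).nullMeasurableSet (measure_ne_top _ _),
      hp a ha, ← hp b hb, hb0, tsub_self]
  filter_upwards [measure_eq_zero_iff_ae_notMem.1 hd] with x hx h0 h
  exact hx ⟨h, h0⟩

/-- For a unit vector `u` and Gaussian `a`, `⟨a, u⟩` is standard normal, so the mean of `|log |⟨a,
u⟩||` is finite and independent of `u`. Tonelli then gives finiteness for almost every `a`. -/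
theorem exists_integrable_log_inner_direction [Nontrivial E] (ν : Measure E) [IsFiniteMeasure ν] :
    ∃ a : E, a ≠ 0 ∧ Integrable (fun x => Real.log (inner ℝ a (‖x‖⁻¹ • x))) ν := by
  have hmeas : Measurable fun z : E × E => Real.log (inner ℝ z.1 (‖z.2‖⁻¹ • z.2)) :=
    Real.measurable_log.comp (measurable_fst.inner
      ((measurable_norm.comp measurable_snd).inv.smul measurable_snd))
  have hbound : ∀ x : E, ∫⁻ a, ‖Real.log (inner ℝ a (‖x‖⁻¹ • x))‖ₑ ∂(stdGaussian E) ≤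
      ∫⁻ t, ‖Real.log t‖ₑ ∂(gaussianReal 0 1) := by
    intro x
    by_cases hx : x = 0
    -- At `x = 0` the integrand vanishes because `Real.log 0 = 0`.
    · simp [hx]
    · rw [← map_inner_stdGaussian (‖x‖⁻¹ • x) (norm_smul_inv_norm (𝕜 := ℝ) hx),
        lintegral_map (by fun_prop) (by fun_prop)]
  have hfin : ∫⁻ a, ∫⁻ x, ‖Real.log (inner ℝ a (‖x‖⁻¹ • x))‖ₑ ∂ν ∂(stdGaussian E) ≠ ⊤ := by
    rw [lintegral_lintegral_swap hmeas.enorm.aemeasurable]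
    refine ((lintegral_mono hbound).trans_lt ?_).ne
    rw [lintegral_const]
    exact ENNReal.mul_lt_top integrable_log_gaussianReal.2 (measure_lt_top _ _)
  have h1 := ae_lt_top (Measurable.lintegral_prod_right' hmeas.enorm) hfin
  have h3 : ∀ᵐ b ∂(stdGaussian E), b ≠ 0 := by
    obtain ⟨e, he⟩ := exists_ne (0 : E)
    filter_upwards [measure_eq_zero_iff_ae_notMem.1 (stdGaussian_inner_eq_zero e he)] with b hb h
    exact hb (by simp [h])
  obtain ⟨a, ha, ha'⟩ := (h3.and h1).exists
  exact ⟨a, ha, (hmeas.comp measurable_prodMk_left).aestronglyMeasurable, ha'⟩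

end Gaussian

/-! ### Logarithmic integrals over directions. -/

section Direction

variable {E : Type*} [NormedAddCommGroup E] [InnerProductSpace ℝ E]

/-- No absolute value is needed, since `Real.log` ignores the sign of its argument. -/
theorem log_inner_direction {a x : E} (hx : x ≠ 0) (h : inner ℝ a x ≠ 0) :
    Real.log (inner ℝ a (‖x‖⁻¹ • x)) = Real.log (inner ℝ a x) - Real.log ‖x‖ := by
  rw [inner_smul_right, Real.log_mul (inv_ne_zero (norm_ne_zero_iff.2 hx)) h, Real.log_inv]
  ring

variable [FiniteDimensional ℝ E] [MeasurableSpace E] [BorelSpace E] {ν : Measure E} {ρ : Measure ℝ}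
  {γ : E → ℝ}

theorem integral_comp_inner_eq (hmap : ∀ a : E, a ≠ 0 →
    ν.map (fun x => inner ℝ a x) = ρ.map (fun y => γ a * y)) {a : E} (ha : a ≠ 0) {g : ℝ → ℝ}
    (hg : Measurable g) :
    ∫ x, g (inner ℝ a x) ∂ν = ∫ y, g (γ a * y) ∂ρ := by
  rw [← integral_map (φ := fun x => inner ℝ a x) (by fun_prop) hg.aestronglyMeasurable, hmap a ha,
    integral_map (by fun_prop) hg.aestronglyMeasurable]

variable [IsFiniteMeasure ν] [IsFiniteMeasure ρ]

/-- Only one-dimensional marginals are known, so the two terms must be transported separately;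
clamping makes each of them integrable. -/
theorem integral_clamp_log_inner_sub (hmap : ∀ a : E, a ≠ 0 →
    ν.map (fun x => inner ℝ a x) = ρ.map (fun y => γ a * y)) {a b : E} (ha : a ≠ 0) (hb : b ≠ 0)
    (T : ℕ) :
    ∫ x, (clamp T (Real.log (inner ℝ a x)) - clamp T (Real.log (inner ℝ b x))) ∂ν =
      ∫ y, (clamp T (Real.log (γ a * y)) - clamp T (Real.log (γ b * y))) ∂ρ := by
  rw [integral_sub (integrable_clamp_comp T (Measurable.aemeasurable (by fun_prop)))
      (integrable_clamp_comp T (Measurable.aemeasurable (by fun_prop))),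
    integral_sub (integrable_clamp_comp T (Measurable.aemeasurable (by fun_prop)))
      (integrable_clamp_comp T (Measurable.aemeasurable (by fun_prop))),
    integral_comp_inner_eq hmap ha (g := fun s => clamp T (Real.log s)) (by fun_prop),
    integral_comp_inner_eq hmap hb (g := fun s => clamp T (Real.log s)) (by fun_prop)]

theorem integrable_log_inner_direction [Nontrivial E] (hγ : ∀ a, a ≠ 0 → 0 < γ a)
    (hmap : ∀ a : E, a ≠ 0 → ν.map (fun x => inner ℝ a x) = ρ.map (fun y => γ a * y))
    (hν : ∀ a : E, a ≠ 0 → ∀ᵐ x ∂ν, inner ℝ a x ≠ 0) (hρ : ∀ᵐ y ∂ρ, y ≠ 0) {a : E} (ha : a ≠ 0) :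
    Integrable (fun x => Real.log (inner ℝ a (‖x‖⁻¹ • x))) ν := by
  obtain ⟨b, hb, hbi⟩ := exists_integrable_log_inner_direction ν
  have hx0 : ∀ᵐ x ∂ν, x ≠ 0 := (hν a ha).mono fun x hx h => hx (by simp [h])
  -- The Cauchy–Schwarz majorant of `log |⟨c, x⟩|`; the nonnegative gap `r a x - log |⟨a, x⟩|` is
  -- what Fatou's lemma is applied to.
  set r : E → E → ℝ := fun c x => Real.log ‖c‖ + Real.log ‖x‖ with hr
  have hrm : ∀ c, AEMeasurable (r c) ν := fun c => Measurable.aemeasurable (by fun_prop)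
  have hlm : ∀ c : E, AEMeasurable (fun x : E => Real.log (inner ℝ c x)) ν := fun c =>
    Measurable.aemeasurable (by fun_prop)
  have hle : ∀ᵐ x ∂ν, Real.log (inner ℝ a x) ≤ r a x := by
    filter_upwards [hx0, hν a ha] with x hx hax
    simp only [hr]
    rw [← Real.log_mul (norm_ne_zero_iff.2 ha) (norm_ne_zero_iff.2 hx), ← Real.log_abs]
    exact Real.log_le_log (abs_pos.2 hax) (abs_real_inner_le_norm a x)
  have hdb : Integrable (fun x => r b x - Real.log (inner ℝ b x)) ν := by
    refine ((integrable_const (Real.log ‖b‖)).sub hbi).congr ?_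
    filter_upwards [hx0, hν b hb] with x hx hbx
    simp only [Pi.sub_apply, log_inner_direction hx hbx, hr]
    ring
  have hi := integrable_sub_of_integral_clamp_le (hrm a) (hlm a) hle
    (∫ x, |Real.log ‖a‖ - Real.log ‖b‖| ∂ν + ∫ x, |r b x - Real.log (inner ℝ b x)| ∂ν +
      ∫ y, |Real.log (γ b) - Real.log (γ a)| ∂ρ) ?_
  · refine ((integrable_const (Real.log ‖a‖)).sub hi).congr ?_
    filter_upwards [hx0, hν a ha] with x hx hax
    simp only [Pi.sub_apply, log_inner_direction hx hax, hr]
    ring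
  · intro T
    have hri := fun c => integrable_clamp_comp T (hrm c)
    have hli := fun c => integrable_clamp_comp T (hlm c)
    -- Of the three unclamped differences, the first is constant, the second is integrable by the
    -- choice of `b`, and the third becomes constant once carried over to `ρ`. This bounds the left
    -- side uniformly in `T`.
    have hsplit : ∫ x, (clamp T (r a x) - clamp T (Real.log (inner ℝ a x))) ∂ν =
        ∫ x, (clamp T (r a x) - clamp T (r b x)) ∂ν +
          ∫ x, (clamp T (r b x) - clamp T (Real.log (inner ℝ b x))) ∂ν +
          ∫ x, (clamp T (Real.log (inner ℝ b x)) - clamp T (Real.log (inner ℝ a x))) ∂ν := by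
      rw [integral_sub (hri a) (hli a), integral_sub (hri a) (hri b),
        integral_sub (hri b) (hli b), integral_sub (hli b) (hli a)]
      ring
    rw [hsplit, integral_clamp_log_inner_sub hmap hb ha]
    refine add_le_add (add_le_add ?_ ?_) ?_
    · refine integral_mono ((hri a).sub (hri b)) (integrable_const _) fun x => ?_
      refine (le_abs_self _).trans ((abs_clamp_sub_clamp_le T _ _).trans_eq ?_)
      simp only [hr]
      ring_nf
    · exact integral_mono ((hri b).sub (hli b)) hdb.abs fun x =>
        (le_abs_self _).trans (abs_clamp_sub_clamp_le T _ _)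
    · refine integral_mono_ae ((integrable_clamp_comp T (Measurable.aemeasurable (by fun_prop))).sub
        (integrable_clamp_comp T (Measurable.aemeasurable (by fun_prop)))) (integrable_const _) ?_
      filter_upwards [hρ] with y hy
      refine (le_abs_self _).trans ((abs_clamp_sub_clamp_le T _ _).trans_eq ?_)
      rw [Real.log_mul (hγ b hb).ne' hy, Real.log_mul (hγ a ha).ne' hy]
      ring_nf

/-- The terms `log ‖x‖` cancel under `ν` and the terms `log |y|` under `ρ`; the clamped integrals on
the two sides agree for every `T`, so their limits agree. -/
theorem integral_log_inner_direction_sub [Nontrivial E] (hγ : ∀ a, a ≠ 0 → 0 < γ a)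
    (hmap : ∀ a : E, a ≠ 0 → ν.map (fun x => inner ℝ a x) = ρ.map (fun y => γ a * y))
    (hν : ∀ a : E, a ≠ 0 → ∀ᵐ x ∂ν, inner ℝ a x ≠ 0) (hρ : ∀ᵐ y ∂ρ, y ≠ 0) {a b : E} (ha : a ≠ 0)
    (hb : b ≠ 0) :
    ∫ x, Real.log (inner ℝ a (‖x‖⁻¹ • x)) ∂ν - ∫ x, Real.log (inner ℝ b (‖x‖⁻¹ • x)) ∂ν =
      ρ.real Set.univ * (Real.log (γ a) - Real.log (γ b)) := by
  have hai := integrable_log_inner_direction hγ hmap hν hρ ha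
  have hbi := integrable_log_inner_direction hγ hmap hν hρ hb
  have hx0 : ∀ᵐ x ∂ν, x ≠ 0 := (hν a ha).mono fun x hx h => hx (by simp [h])
  have heq : (fun x => Real.log (inner ℝ a (‖x‖⁻¹ • x)) - Real.log (inner ℝ b (‖x‖⁻¹ • x)))
      =ᵐ[ν] fun x => Real.log (inner ℝ a x) - Real.log (inner ℝ b x) := by
    filter_upwards [hx0, hν a ha, hν b hb] with x hx hax hbx
    rw [log_inner_direction hx hax, log_inner_direction hx hbx]
    ring
  have heq' : (fun _ => Real.log (γ a) - Real.log (γ b)) =ᵐ[ρ]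
      fun y => Real.log (γ a * y) - Real.log (γ b * y) := by
    filter_upwards [hρ] with y hy
    rw [Real.log_mul (hγ b hb).ne' hy, Real.log_mul (hγ a ha).ne' hy]
    ring
  have h1 := tendsto_integral_clamp_sub_clamp (κ := ν) (Measurable.aemeasurable (by fun_prop))
    (Measurable.aemeasurable (by fun_prop)) ((hai.sub hbi).congr heq)
  have h2 := tendsto_integral_clamp_sub_clamp (κ := ρ) (Measurable.aemeasurable (by fun_prop))
    (Measurable.aemeasurable (by fun_prop)) ((integrable_const _).congr heq')
  simp_rw [integral_clamp_log_inner_sub hmap ha hb] at h1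
  rw [← integral_sub hai hbi, integral_congr_ae heq, tendsto_nhds_unique h1 h2,
    ← integral_congr_ae heq', integral_const, smul_eq_mul]

end Direction

/-! ### Homogeneity and continuity of the standard. -/

section Standard

variable {n : ℕ} {Ω Ω' : Type*} [MeasurableSpace Ω] [MeasurableSpace Ω']
  {P : Measure Ω} {P' : Measure Ω'}
  {X : Ω → EuclideanSpace ℝ (Fin n)} {Y : Ω' → ℝ} {γ : EuclideanSpace ℝ (Fin n) → ℝ}

theorem IsVersionWithStandard.identDistrib_inner (hγ : IsVersionWithStandard P P' X Y γ)
    (a : EuclideanSpace ℝ (Fin n)) :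
    IdentDistrib (fun ω => inner ℝ a (X ω)) (fun ω' => γ a * Y ω') P P' := by
  convert hγ.identDistrib a using 2 with ω
  simp [PiLp.inner_apply, mul_comm]

variable [IsProbabilityMeasure P']

theorem measure_ne_zero_pos (hm : AEMeasurable Y P') (hY : P' {ω' | Y ω' = 0} < 1) :
    P' {ω' | Y ω' ≠ 0} ≠ 0 := by
  intro h
  refine hY.ne ((prob_compl_eq_zero_iff₀ ?_).1 h)
  exact hm.nullMeasurableSet_preimage (measurableSet_singleton 0)

/-- A bounded strictly increasing test function recovers the scale `c` from the law of `c |Y|`;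
strictness comes from `P'(Y ≠ 0) > 0`. -/
theorem strictMonoOn_integral_arctan_mul_abs (hm : AEMeasurable Y P')
    (hY : P' {ω' | Y ω' = 0} < 1) :
    StrictMonoOn (fun c => ∫ ω', Real.arctan (c * |Y ω'|) ∂P') (Set.Ici 0) := by
  have hi : ∀ c : ℝ, Integrable (fun ω' => Real.arctan (c * |Y ω'|)) P' := fun c => by
    refine Integrable.of_bound (Real.measurable_arctan.comp_aemeasurable
      ((measurable_const.mul measurable_abs).comp_aemeasurable hm)).aestronglyMeasurable
      (Real.pi / 2) (Filter.Eventually.of_forall fun ω' => ?_)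
    rw [Real.norm_eq_abs, abs_le]
    exact ⟨(Real.neg_pi_div_two_lt_arctan _).le, (Real.arctan_lt_pi_div_two _).le⟩
  intro c _ d _ hcd
  have hle : ∀ ω', 0 ≤ Real.arctan (d * |Y ω'|) - Real.arctan (c * |Y ω'|) := fun ω' =>
    sub_nonneg.2 (Real.arctan_mono (mul_le_mul_of_nonneg_right hcd.le (abs_nonneg _)))
  change ∫ ω', Real.arctan (c * |Y ω'|) ∂P' < ∫ ω', Real.arctan (d * |Y ω'|) ∂P'
  rw [← sub_pos, ← integral_sub (hi d) (hi c),
    integral_pos_iff_support_of_nonneg hle ((hi d).sub (hi c))]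
  refine pos_iff_ne_zero.2 fun h => measure_ne_zero_pos hm hY (measure_mono_null ?_ h)
  intro ω' hω'
  exact (sub_pos.2 (Real.arctan_strictMono
    (mul_lt_mul_of_pos_right hcd (abs_pos.2 hω')))).ne'

namespace IsVersionWithStandard

theorem standard_zero (hγ : IsVersionWithStandard P P' X Y γ) (hY : P' {ω' | Y ω' = 0} < 1) :
    γ 0 = 0 := by
  by_contra h0
  have h := (hγ.identDistrib 0).measure_mem_eq (measurableSet_singleton (0 : ℝ)).compl
  refine measure_ne_zero_pos hγ.aemeasurable_variable hY ?_
  have h1 : (fun ω' => γ 0 * Y ω') ⁻¹' {0}ᶜ = {ω' | Y ω' ≠ 0} := by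
    ext ω'
    simp [h0]
  rw [← h1, ← h]
  simp

theorem standard_nonneg (hγ : IsVersionWithStandard P P' X Y γ) (hY : P' {ω' | Y ω' = 0} < 1)
    (a : EuclideanSpace ℝ (Fin n)) : 0 ≤ γ a := by
  rcases eq_or_ne a 0 with rfl | ha
  · exact (hγ.standard_zero hY).ge
  · exact (hγ.pos a ha).le

theorem integral_arctan_inner (hγ : IsVersionWithStandard P P' X Y γ)
    (hY : P' {ω' | Y ω' = 0} < 1) (a : EuclideanSpace ℝ (Fin n)) :
    ∫ ω, Real.arctan |inner ℝ a (X ω)| ∂P = ∫ ω', Real.arctan (γ a * |Y ω'|) ∂P' := by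
  have h := ((hγ.identDistrib_inner a).comp
    (Real.measurable_arctan.comp measurable_abs)).integral_eq
  simpa [Function.comp_def, abs_mul, abs_of_nonneg (hγ.standard_nonneg hY a)] using h

theorem standard_smul (hγ : IsVersionWithStandard P P' X Y γ) (hY : P' {ω' | Y ω' = 0} < 1)
    (t : ℝ) (a : EuclideanSpace ℝ (Fin n)) : γ (t • a) = |t| * γ a := by
  refine (strictMonoOn_integral_arctan_mul_abs hγ.aemeasurable_variable hY).injOn
    (hγ.standard_nonneg hY _) (mul_nonneg (abs_nonneg t) (hγ.standard_nonneg hY a)) ?_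
  have h := ((hγ.identDistrib_inner a).comp (u := fun s => Real.arctan |t * s|)
    (Real.measurable_arctan.comp (measurable_abs.comp (measurable_const_mul t)))).integral_eq
  rw [← hγ.integral_arctan_inner hY]
  simpa [Function.comp_def, real_inner_smul_left, abs_mul,
    abs_of_nonneg (hγ.standard_nonneg hY a), mul_assoc] using h

theorem continuous_standard [IsFiniteMeasure P] (hγ : IsVersionWithStandard P P' X Y γ)
    (hY : P' {ω' | Y ω' = 0} < 1) : Continuous γ := by
  have hmono := strictMonoOn_integral_arctan_mul_abs hγ.aemeasurable_variable hY
  have hcont : Continuous fun a => ∫ ω', Real.arctan (γ a * |Y ω'|) ∂P' := by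
    simp_rw [← hγ.integral_arctan_inner hY]
    refine continuous_of_dominated (bound := fun _ => Real.pi / 2) (fun a => ?_)
      (fun a => Filter.Eventually.of_forall fun ω => ?_) (integrable_const _)
      (Filter.Eventually.of_forall fun ω => ?_)
    · exact ((Real.measurable_arctan.comp measurable_abs).comp_aemeasurable
        (hγ.identDistrib_inner a).aemeasurable_fst).aestronglyMeasurable
    · rw [Real.norm_eq_abs, abs_le]
      exact ⟨(Real.neg_pi_div_two_lt_arctan _).le, (Real.arctan_lt_pi_div_two _).le⟩
    · exact Real.continuous_arctan.comp (by fun_prop)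
  rw [continuous_iff_continuousAt]
  intro a
  -- A strictly increasing function of `γ` is continuous in `a`; comparing its values pulls order
  -- neighbourhoods back to `γ`.
  rw [ContinuousAt, tendsto_order]
  refine ⟨fun l hl => ?_, fun u hu => ?_⟩
  · rcases lt_or_ge l 0 with h0 | h0
    · exact Filter.Eventually.of_forall fun b => h0.trans_le (hγ.standard_nonneg hY b)
    · filter_upwards [hcont.continuousAt.eventually
        (lt_mem_nhds (hmono h0 (hγ.standard_nonneg hY a) hl))] with b hb
      exact (hmono.lt_iff_lt h0 (hγ.standard_nonneg hY b)).1 hb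
  · have h0 : 0 ≤ u := (hγ.standard_nonneg hY a).trans hu.le
    filter_upwards [hcont.continuousAt.eventually
      (gt_mem_nhds (hmono (hγ.standard_nonneg hY a) h0 hu))] with b hb
    exact (hmono.lt_iff_lt (hγ.standard_nonneg hY b) h0).1 hb

end IsVersionWithStandard

end Standard

/-! ### Unit balls of homogeneous functions as star bodies. -/

section StarBody

variable {n : ℕ} {N : EuclideanSpace ℝ (Fin n) → ℝ}

theorem gauge_setOf_le_one {E : Type*} [AddCommGroup E] [Module ℝ E] {N : E → ℝ}
    (hnn : ∀ x, 0 ≤ N x) (hsmul : ∀ (t : ℝ) x, N (t • x) = |t| * N x) :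
    gauge {x | N x ≤ 1} = N := by
  ext x
  have hset : {r : ℝ | 0 < r ∧ x ∈ r • {x | N x ≤ 1}} = {r | 0 < r ∧ N x ≤ r} := by
    ext r
    refine and_congr_right fun hr => ?_
    rw [Set.mem_smul_set_iff_inv_smul_mem₀ hr.ne']
    change N (r⁻¹ • x) ≤ 1 ↔ _
    rw [hsmul, abs_of_pos (inv_pos.2 hr), inv_mul_le_one₀ hr]
  rw [gauge_def]
  refine le_antisymm (le_of_forall_gt_imp_ge_of_dense fun r hr => ?_) ?_
  · have hr0 : 0 < r := (hnn x).trans_lt hr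
    refine csInf_le ⟨0, fun s hs => hs.1.le⟩ ?_
    have : r ∈ {r : ℝ | 0 < r ∧ N x ≤ r} := ⟨hr0, hr.le⟩
    rwa [← hset] at this
  · have hset' : {r : ℝ | r ∈ Set.Ioi 0 ∧ x ∈ r • {x | N x ≤ 1}} = {r | 0 < r ∧ N x ≤ r} := hset
    rw [hset']
    exact le_csInf ⟨N x + 1, by linarith [hnn x], by linarith⟩ fun r hr => hr.2

theorem isStarBody_setOf_le_one (hcont : Continuous N) (h0 : N 0 = 0) (hpos : ∀ x, x ≠ 0 → 0 < N x)
    (hsmul : ∀ (t : ℝ) x, N (t • x) = |t| * N x) : IsStarBody {x | N x ≤ 1} := by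
  have hnn : ∀ x, 0 ≤ N x := fun x => by
    rcases eq_or_ne x 0 with rfl | hx
    · exact h0.ge
    · exact (hpos x hx).le
  refine ⟨isClosed_le hcont continuous_const, ?_, ?_, ?_, ?_⟩
  · have hK : IsCompact (Metric.sphere (0 : EuclideanSpace ℝ (Fin n)) 1) := isCompact_sphere 0 1
    -- The sphere is empty when `n = 0`. Otherwise the minimum of `N` on it bounds the radius.
    rcases (Metric.sphere (0 : EuclideanSpace ℝ (Fin n)) 1).eq_empty_or_nonempty with he | hne
    · refine (Metric.isBounded_closedBall (x := 0) (r := 0)).subset fun x _ => ?_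
      by_contra hx
      have hx0 : x ≠ 0 := fun h => hx (by simp [h])
      have : ‖x‖⁻¹ • x ∈ Metric.sphere (0 : EuclideanSpace ℝ (Fin n)) 1 :=
        mem_sphere_zero_iff_norm.2 (norm_smul_inv_norm (𝕜 := ℝ) hx0)
      rw [he] at this
      exact this
    · obtain ⟨e, he, hmin⟩ := hK.exists_isMinOn hne hcont.continuousOn
      have hNe : 0 < N e := hpos e (by
        rintro rfl
        simp at he)
      refine (Metric.isBounded_closedBall (x := 0) (r := (N e)⁻¹)).subset fun x hx => ?_
      rw [mem_closedBall_zero_iff]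
      rcases eq_or_ne x 0 with rfl | hx0
      · simpa using hNe.le
      have hm : N e ≤ N (‖x‖⁻¹ • x) :=
        hmin (mem_sphere_zero_iff_norm.2 (norm_smul_inv_norm (𝕜 := ℝ) hx0))
      have hx1 : N x ≤ 1 := hx
      have hnx : 0 < ‖x‖ := norm_pos_iff.2 hx0
      rw [hsmul, abs_of_pos (inv_pos.2 hnx)] at hm
      rw [le_inv_comm₀ hnx hNe]
      exact hm.trans (mul_le_of_le_one_right (inv_pos.2 hnx).le hx1)
  · intro u hu
    have hNu := hpos u hu
    have hfr : frontier {x | N x ≤ 1} = {x | N x = 1} := by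
      refine Set.Subset.antisymm (frontier_le_subset_eq hcont continuous_const) fun x hx => ?_
      have hx1 : N x = 1 := hx
      refine ⟨subset_closure hx1.le, fun hint => ?_⟩
      -- Points `t • x` with `t > 1` close to 1 leave the set, so `x` is not interior.
      have ht : Filter.Tendsto (fun t : ℝ => t • x) (nhdsWithin 1 (Set.Ioi 1)) (nhds x) := by
        have : Continuous fun t : ℝ => t • x := by fun_prop
        simpa using (this.tendsto 1).mono_left nhdsWithin_le_nhds
      obtain ⟨t, ht1, ht2⟩ := ((ht.eventually (mem_interior_iff_mem_nhds.1 hint)).and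
        self_mem_nhdsWithin).exists
      have ht3 : (1 : ℝ) < t := ht2
      have ht4 : N (t • x) ≤ 1 := ht1
      rw [hsmul, hx1, mul_one, abs_of_pos (by linarith)] at ht4
      linarith
    have heq : frontier {x | N x ≤ 1} ∩ Set.range (fun t : ℝ => t • u) =
        {(N u)⁻¹ • u, (-(N u)⁻¹) • u} := by
      rw [hfr]
      ext x
      simp only [Set.mem_inter_iff, Set.mem_range, Set.mem_insert_iff, Set.mem_singleton_iff]
      constructor
      · rintro ⟨hx, t, rfl⟩
        have hx' : N (t • u) = 1 := hx
        rw [hsmul] at hx'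
        have : |t| = (N u)⁻¹ := eq_inv_of_mul_eq_one_left hx'
        rcases eq_or_eq_neg_of_abs_eq this with h | h
        · exact Or.inl (by rw [h])
        · exact Or.inr (by rw [h])
      · rintro (rfl | rfl)
        · refine ⟨?_, _, rfl⟩
          change N _ = 1
          rw [hsmul, abs_of_pos (inv_pos.2 hNu), inv_mul_cancel₀ hNu.ne']
        · refine ⟨?_, _, rfl⟩
          change N _ = 1
          rw [hsmul, abs_neg, abs_of_pos (inv_pos.2 hNu), inv_mul_cancel₀ hNu.ne']
    rw [heq]
    refine Set.ncard_pair fun h => ?_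
    have := smul_left_injective ℝ hu h
    have := inv_pos.2 hNu
    linarith
  · rw [mem_interior_iff_mem_nhds]
    have : ∀ᶠ x in nhds (0 : EuclideanSpace ℝ (Fin n)), N x < 1 :=
      hcont.continuousAt.eventually (gt_mem_nhds (by rw [h0]; exact one_pos))
    exact this.mono fun x hx => hx.le
  · rw [gauge_setOf_le_one hnn hsmul]
    exact hcont

end StarBody

/-! ### The representing measure on the sphere. -/

section Embedding

variable {n : ℕ} {Ω Ω' : Type*} [MeasurableSpace Ω] [MeasurableSpace Ω']
  {P : Measure Ω} [IsProbabilityMeasure P] {P' : Measure Ω'} [IsProbabilityMeasure P']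
  {X : Ω → EuclideanSpace ℝ (Fin n)} {Y : Ω' → ℝ} {γ : EuclideanSpace ℝ (Fin n) → ℝ}

/-- If `ln N` differs by a constant from the integral of `ln |⟨a, x / ‖x‖⟩|` divided by `q`, then the
law of the direction `x / ‖x‖`, divided by `q`, represents `N`. -/
theorem embedsInLZero_of_integral_direction [Nontrivial (EuclideanSpace ℝ (Fin n))]
    {ν : Measure (EuclideanSpace ℝ (Fin n))} [IsFiniteMeasure ν] {q : ℝ} (hq : 0 < q)
    {N : EuclideanSpace ℝ (Fin n) → ℝ}
    (hν : ∀ a : EuclideanSpace ℝ (Fin n), a ≠ 0 → ∀ᵐ x ∂ν, inner ℝ a x ≠ 0)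
    (hi : ∀ a : EuclideanSpace ℝ (Fin n), a ≠ 0 →
      Integrable (fun x => Real.log (inner ℝ a (‖x‖⁻¹ • x))) ν)
    (hN : ∀ a b : EuclideanSpace ℝ (Fin n), a ≠ 0 → b ≠ 0 →
      ∫ x, Real.log (inner ℝ a (‖x‖⁻¹ • x)) ∂ν - ∫ x, Real.log (inner ℝ b (‖x‖⁻¹ • x)) ∂ν =
        q * (Real.log (N a) - Real.log (N b))) :
    EmbedsInLZero N := by
  classical
  obtain ⟨e, he⟩ := exists_ne (0 : EuclideanSpace ℝ (Fin n))
  have hx0 : ∀ᵐ x ∂ν, x ≠ 0 := (hν e he).mono fun x hx h => hx (by simp [h])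
  have hsphere : ∀ x : EuclideanSpace ℝ (Fin n), x ≠ 0 →
      ‖x‖⁻¹ • x ∈ Metric.sphere (0 : EuclideanSpace ℝ (Fin n)) 1 := fun x hx =>
    mem_sphere_zero_iff_norm.2 (norm_smul_inv_norm (𝕜 := ℝ) hx)
  -- The value at `0` is arbitrary, as `ν` does not charge the origin; it only keeps `v` on the
  -- sphere.
  let v : EuclideanSpace ℝ (Fin n) → EuclideanSpace ℝ (Fin n) := fun x =>
    if x = 0 then ‖e‖⁻¹ • e else ‖x‖⁻¹ • x
  have hvm : Measurable v :=
    Measurable.ite (measurableSet_singleton 0) measurable_const (by fun_prop)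
  have hvs : ∀ x, v x ∈ Metric.sphere (0 : EuclideanSpace ℝ (Fin n)) 1 := fun x => by
    by_cases hx : x = 0
    · simp only [v, if_pos hx]
      exact hsphere e he
    · simp only [v, if_neg hx]
      exact hsphere x hx
  let d : EuclideanSpace ℝ (Fin n) → Metric.sphere (0 : EuclideanSpace ℝ (Fin n)) 1 :=
    fun x => ⟨v x, hvs x⟩
  have hd : Measurable d := hvm.subtype_mk
  have hdx : ∀ᵐ x ∂ν, (d x : EuclideanSpace ℝ (Fin n)) = ‖x‖⁻¹ • x := by
    filter_upwards [hx0] with x hx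
    simp [d, v, hx]
  let μ := ENNReal.ofReal q⁻¹ • ν.map d
  have hlm : ∀ a : EuclideanSpace ℝ (Fin n), Measurable
      fun ξ : Metric.sphere (0 : EuclideanSpace ℝ (Fin n)) 1 => Real.log |inner ℝ a ξ.1| :=
    fun a => by fun_prop
  have hlog : ∀ a : EuclideanSpace ℝ (Fin n),
      (fun x => Real.log |inner ℝ a (d x : EuclideanSpace ℝ (Fin n))|) =ᵐ[ν]
        fun x => Real.log (inner ℝ a (‖x‖⁻¹ • x)) := fun a => by
    filter_upwards [hdx] with x hx
    rw [hx, Real.log_abs]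
  have hint : ∀ a : EuclideanSpace ℝ (Fin n), ∫ ξ, Real.log |inner ℝ a ξ.1| ∂μ =
      q⁻¹ * ∫ x, Real.log (inner ℝ a (‖x‖⁻¹ • x)) ∂ν := fun a => by
    rw [integral_smul_measure, integral_map hd.aemeasurable (hlm a).aestronglyMeasurable,
      integral_congr_ae (hlog a), ENNReal.toReal_ofReal (inv_pos.2 hq).le, smul_eq_mul]
  -- The constant is chosen to make the formula exact at `e`.
  refine ⟨μ, Real.log (N e) - ∫ ξ, Real.log |inner ℝ e ξ.1| ∂μ, ?_, fun a ha => ⟨?_, ?_, ?_⟩⟩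
  · exact Measure.smul_finite _ ENNReal.ofReal_ne_top
  · refine Measure.ae_smul_measure ?_ _
    rw [ae_map_iff hd.aemeasurable]
    · filter_upwards [hdx, hx0, hν a ha] with x hx hx1 hax
      rw [hx, inner_smul_right]
      exact mul_ne_zero (inv_ne_zero (norm_ne_zero_iff.2 hx1)) hax
    · have : Measurable fun ξ : Metric.sphere (0 : EuclideanSpace ℝ (Fin n)) 1 =>
          inner ℝ a ξ.1 := by fun_prop
      exact this (measurableSet_singleton (0 : ℝ)).compl
  · refine Integrable.smul_measure ?_ ENNReal.ofReal_ne_top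
    rw [integrable_map_measure (hlm a).aestronglyMeasurable hd.aemeasurable]
    exact (hi a ha).congr (hlog a).symm
  · have h := hN a e ha he
    rw [hint, hint]
    have h' : Real.log (N a) - Real.log (N e) = q⁻¹ *
        (∫ x, Real.log (inner ℝ a (‖x‖⁻¹ • x)) ∂ν - ∫ x, Real.log (inner ℝ e (‖x‖⁻¹ • x)) ∂ν) := by
      rw [h, inv_mul_cancel_left₀ hq.ne']
    linarith

theorem IsVersionWithStandard.embedsInLZero [Nontrivial (EuclideanSpace ℝ (Fin n))]
    (hγ : IsVersionWithStandard P P' X Y γ) (hY : P' {ω' | Y ω' = 0} < 1) : EmbedsInLZero γ := by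
  have hmap : ∀ a : EuclideanSpace ℝ (Fin n),
      (P.map X).map (fun x => inner ℝ a x) = (P'.map Y).map (fun y => γ a * y) := fun a => by
    rw [AEMeasurable.map_map_of_aemeasurable (by fun_prop) hγ.aemeasurable_vector,
      AEMeasurable.map_map_of_aemeasurable (by fun_prop) hγ.aemeasurable_variable]
    exact (hγ.identDistrib_inner a).map_eq
  have : IsProbabilityMeasure (P.map X) :=
    Measure.isProbabilityMeasure_map hγ.aemeasurable_vector
  have : IsProbabilityMeasure (P'.map Y) :=
    Measure.isProbabilityMeasure_map hγ.aemeasurable_variable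
  have hpre : ∀ a, a ≠ 0 → (fun y => γ a * y) ⁻¹' {0} = {0} := fun a ha => by
    ext y
    simp [(hγ.pos a ha).ne']
  have hplane : ∀ a : EuclideanSpace ℝ (Fin n), a ≠ 0 →
      P.map X {x | inner ℝ a x = 0} = P'.map Y {0} := fun a ha => by
    have h := congrArg (fun m => m {(0 : ℝ)}) (hmap a)
    beta_reduce at h
    rw [Measure.map_apply (by fun_prop) (measurableSet_singleton 0),
      Measure.map_apply (by fun_prop) (measurableSet_singleton 0), hpre a ha] at h
    exact h
  have hne := ae_inner_ne_zero_of_measure_eq _ hplane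
  have hν : ∀ a : EuclideanSpace ℝ (Fin n), a ≠ 0 →
      ∀ᵐ x ∂((P.map X).restrict {0}ᶜ), inner ℝ a x ≠ 0 := fun a ha =>
    (ae_restrict_iff' (measurableSet_singleton 0).compl).2 (hne a ha)
  have hρ : ∀ᵐ y ∂((P'.map Y).restrict {0}ᶜ), y ≠ 0 :=
    ae_restrict_mem (measurableSet_singleton (0 : ℝ)).compl
  have hmap' : ∀ a : EuclideanSpace ℝ (Fin n), a ≠ 0 →
      ((P.map X).restrict {0}ᶜ).map (fun x => inner ℝ a x) =
        ((P'.map Y).restrict {0}ᶜ).map (fun y => γ a * y) := fun a ha => by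
    -- Hyperplanes are null off the origin, so deleting the origin before projecting amounts to
    -- deleting `0` afterwards.
    have hset : ({0}ᶜ : Set (EuclideanSpace ℝ (Fin n))) =ᵐ[P.map X]
        (fun x => inner ℝ a x) ⁻¹' {(0 : ℝ)}ᶜ := by
      filter_upwards [hne a ha] with x hx
      exact propext ⟨fun h => hx h, fun h h' => h (by
        have h'' : x = 0 := h'
        simp [h''])⟩
    have h := congrArg (fun m => m.restrict {(0 : ℝ)}ᶜ) (hmap a)
    beta_reduce at h
    rw [Measure.restrict_map (by fun_prop) (measurableSet_singleton 0).compl,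
      Measure.restrict_map (by fun_prop) (measurableSet_singleton 0).compl,
      Set.preimage_compl (s := {0}) (f := fun y => γ a * y), hpre a ha] at h
    rw [Measure.restrict_congr_set hset, h]
  have hq : 0 < ((P'.map Y).restrict {0}ᶜ).real Set.univ := by
    rw [measureReal_restrict_apply_univ]
    refine ENNReal.toReal_pos ?_ (measure_ne_top _ _)
    rw [Measure.map_apply_of_aemeasurable hγ.aemeasurable_variable
      (measurableSet_singleton 0).compl]
    exact measure_ne_zero_pos hγ.aemeasurable_variable hY
  exact embedsInLZero_of_integral_direction hq hν
    (fun a ha => integrable_log_inner_direction hγ.pos hmap' hν hρ ha)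
    (fun a b ha hb => integral_log_inner_direction_sub hγ.pos hmap' hν hρ ha hb)

end Embedding

theorem corollary1 {n : ℕ} (hn : 2 ≤ n) {Ω Ω' : Type*} [MeasurableSpace Ω] [MeasurableSpace Ω']
    (P : Measure Ω) [IsProbabilityMeasure P] (P' : Measure Ω') [IsProbabilityMeasure P']
    (X : Ω → EuclideanSpace ℝ (Fin n)) (Y : Ω' → ℝ) (γ : EuclideanSpace ℝ (Fin n) → ℝ)
    (hY : P' {ω' | Y ω' = 0} < 1) (hγ : IsVersionWithStandard P P' X Y γ) :
    ∃ K : Set (EuclideanSpace ℝ (Fin n)),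
      IsStarBody K ∧ -K = K ∧ γ = gauge K ∧ EmbedsInLZero (gauge K) := by
  have : Nonempty (Fin n) := ⟨⟨0, by omega⟩⟩
  have hgauge := gauge_setOf_le_one (hγ.standard_nonneg hY) (hγ.standard_smul hY)
  refine ⟨{x | γ x ≤ 1}, isStarBody_setOf_le_one (hγ.continuous_standard hY)
    (hγ.standard_zero hY) hγ.pos (hγ.standard_smul hY), ?_, hgauge.symm, ?_⟩
  · ext x
    change γ (-x) ≤ 1 ↔ γ x ≤ 1
    have h := hγ.standard_smul hY (-1) x
    simp only [neg_smul, one_smul, abs_neg, abs_one, one_mul] at h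
    rw [h]
  · rw [hgauge]
    exact hγ.embedsInLZero hY
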